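/- Let $E$ be a Dedekind complete (real) vector lattice. Let $\mathcal{L}_{\mathrm{ob}}(E)$ be the vector lattice of order bounded linear operators on $E$, with the operator order ($S\le T$ when $Sx\le Tx$ for all $x\ge 0$), and let $\mathrm{Orth}(E)$ be the vector sublattice of $\mathcal{L}_{\mathrm{ob}}(E)$ that consists of the orthomorphisms, that is, of the order bounded operators $T$ such that $T(B)\subseteq B$ for every band $B$ in $E$. For a subset $S$ of $E$, let $B_S$ denote the band in $E$ generated by $S$; an element $e\in E$ is called a weak order unit when $B_{\{e\}}=E$. A net $(x_\alpha)_{\alpha\in A}$ in a vector lattice $X$ is order convergent to $x\in X$, written $x_\alpha\xrightarrow{\mathrm{o}}x$ in $X$, when there is a net $(y_\beta)_{\beta\in B}$ in $X$, over a possibly different index set, such that $y_\beta\downarrow 0$ and such that for every $\beta_0\in B$ there is an $\alpha_0\in A$ with $|x-x_\alpha|\le y_{\beta_0}$ for all $\alpha\ge\alpha_0$. Let $(T_\alpha)_{\alpha\in A}$ be a net in $\mathrm{Orth}(E)$ that is order bounded in $\mathcal{L}_{\mathrm{ob}}(E)$. Let $S$ be a non-empty subset of $E$ with $B_S=E$.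 Then the following are equivalent: 1. $T_\alpha\xrightarrow{\mathrm{o}}0$ in $\mathrm{Orth}(E)$; 2. $T_\alpha\xrightarrow{\mathrm{o}}0$ in $\mathcal{L}_{\mathrm{ob}}(E)$; 3. $T_\alpha s\xrightarrow{\mathrm{o}}0$ in $E$ for all $s\in S$; 4. $T_\alpha x\xrightarrow{\mathrm{o}}0$ in $E$ for all $x\in E$. In particular, when $E$ has a weak order unit $e$, then $T_\alpha\xrightarrow{\mathrm{o}}0$ in $\mathcal{L}_{\mathrm{ob}}(E)$ if and only if $T_\alpha e\xrightarrow{\mathrm{o}}0$ in $E$. -/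

import Mathlib

open Set

namespace VectorLattice

universe u v

section Basic

variable {E : Type u} [AddCommGroup E] [Lattice E]

/-- Order convergence of the net `x : A → E` to `l`: there is a net `y` (over an index set that
may differ from `A`) decreasing to `0` such that every `y β` eventually dominates `|l - x α|`.
It is no restriction to take the index set `B` in the universe of `E`: for a net `y` decreasing
to `0` over any index set, the range of `y`, ordered by `≥`, is an index set that does as well. -/
def OrderTendsto {A : Type v} [Preorder A] (x : A → E) (l : E) : Prop :=
  ∃ (B : Type u) (_ : Preorder B) (_ : IsDirectedOrder B) (_ : Nonempty B) (y : B → E),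
    Antitone y ∧ IsGLB (range y) 0 ∧
      ∀ β : B, ∃ α₀ : A, ∀ α : A, α₀ ≤ α → |l - x α| ≤ y β

variable [Module ℝ E]

/-- A band: a solid linear subspace (an ideal) that contains the supremum of each of its subsets
that has a supremum in `E`. -/
structure IsBand (B : Submodule ℝ E) : Prop where
  solid : LatticeOrderedAddCommGroup.IsSolid (B : Set E)
  isLUB_mem : ∀ (s : Set E) (x : E), s ⊆ B → IsLUB s x → x ∈ B

/-- The band generated by `S`: the intersection of all bands that contain `S`. -/
def bandGenerated (S : Set E) : Submodule ℝ E :=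
  sInf {B : Submodule ℝ E | IsBand B ∧ S ⊆ B}

/-- A weak order unit (not required to be positive): the band it generates is everything. -/
def IsWeakOrderUnit (e : E) : Prop :=
  bandGenerated {e} = ⊤

/-- An order bounded operator maps order intervals into order intervals. -/
def IsOrderBoundedOp (T : E →ₗ[ℝ] E) : Prop :=
  ∀ a b : E, ∃ c d : E, T '' Icc a b ⊆ Icc c d

/-- A band preserving operator maps every band into itself. -/
def IsBandPreserving (T : E →ₗ[ℝ] E) : Prop :=
  ∀ B : Submodule ℝ E, IsBand B → ∀ x ∈ B, T x ∈ B

end Basic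

section OrderBounded

variable (E : Type u) [AddCommGroup E] [Lattice E] [IsOrderedAddMonoid E]
  [Module ℝ E] [IsOrderedModule ℝ E]

/-- The vector space of order bounded operators on `E`. -/
def Lob : Submodule ℝ (E →ₗ[ℝ] E) where
  carrier := {T | IsOrderBoundedOp T}
  add_mem' := by
    intro S T hS hT a b
    obtain ⟨c, d, h⟩ := hS a b
    obtain ⟨c', d', h'⟩ := hT a b
    refine ⟨c + c', d + d', ?_⟩
    rintro _ ⟨x, hx, rfl⟩
    have h1 := h ⟨x, hx, rfl⟩
    have h2 := h' ⟨x, hx, rfl⟩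
    exact ⟨add_le_add h1.1 h2.1, add_le_add h1.2 h2.2⟩
  zero_mem' := by
    intro a b
    refine ⟨0, 0, ?_⟩
    rintro _ ⟨x, hx, rfl⟩
    simp
  smul_mem' := by
    intro r T hT a b
    obtain ⟨c, d, h⟩ := hT a b
    rcases le_total 0 r with hr | hr
    · refine ⟨r • c, r • d, ?_⟩
      rintro _ ⟨x, hx, rfl⟩
      have h1 := h ⟨x, hx, rfl⟩
      exact ⟨smul_le_smul_of_nonneg_left h1.1 hr, smul_le_smul_of_nonneg_left h1.2 hr⟩
    · refine ⟨r • d, r • c, ?_⟩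
      rintro _ ⟨x, hx, rfl⟩
      have h1 := h ⟨x, hx, rfl⟩
      exact ⟨smul_le_smul_of_nonpos_left h1.2 hr, smul_le_smul_of_nonpos_left h1.1 hr⟩

variable {E}

/-- The operator order: `S ≤ T` when `S x ≤ T x` for all `x ≥ 0`. -/
instance : PartialOrder (Lob E) where
  le S T := ∀ x : E, 0 ≤ x → S.1 x ≤ T.1 x
  le_refl S x _ := le_rfl
  le_trans S T U h h' x hx := (h x hx).trans (h' x hx)
  le_antisymm S T h h' := by
    have key : ∀ x : E, 0 ≤ x → S.1 x = T.1 x := fun x hx => le_antisymm (h x hx) (h' x hx)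
    ext x
    have e1 := key x⁺ (posPart_nonneg x)
    have e2 := key x⁻ (negPart_nonneg x)
    rw [← posPart_sub_negPart x, map_sub, map_sub, e1, e2]

theorem Lob.le_def {S T : Lob E} : S ≤ T ↔ ∀ x : E, 0 ≤ x → S.1 x ≤ T.1 x := Iff.rfl

instance : IsOrderedAddMonoid (Lob E) where
  add_le_add_left _ _ h U x hx := add_le_add_left (h x hx) (U.1 x)

instance : IsOrderedModule ℝ (Lob E) where
  smul_le_smul_of_nonneg_left r hr _ _ h x hx := smul_le_smul_of_nonneg_left (h x hx) hr
  smul_le_smul_of_nonneg_right S hS _ _ hrs x hx :=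
    smul_le_smul_of_nonneg_right hrs (by simpa using hS x hx)

end OrderBounded

section Lattice

variable {E : Type u} [AddCommGroup E] [ConditionallyCompleteLattice E] [IsOrderedAddMonoid E]
  [Module ℝ E] [IsOrderedModule ℝ E]

/-- The Riesz-Kantorovich formula for the positive part of `T`, meant for `x ≥ 0`. -/
noncomputable def rk (T : Lob E) (x : E) : E := sSup (T.1 '' Icc 0 x)

theorem rk_isLUB (T : Lob E) {x : E} (hx : 0 ≤ x) : IsLUB (T.1 '' Icc 0 x) (rk T x) := by
  refine isLUB_csSup ⟨T.1 0, 0, ⟨le_rfl, hx⟩, rfl⟩ ?_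
  obtain ⟨c, d, h⟩ := T.2 0 x
  exact ⟨d, fun _ hy => (h hy).2⟩

theorem le_rk (T : Lob E) {x z : E} (hz : 0 ≤ z) (hzx : z ≤ x) : T.1 z ≤ rk T x :=
  (rk_isLUB T (hz.trans hzx)).1 ⟨z, ⟨hz, hzx⟩, rfl⟩

theorem rk_le (T : Lob E) {x b : E} (hx : 0 ≤ x) (h : ∀ z, 0 ≤ z → z ≤ x → T.1 z ≤ b) :
    rk T x ≤ b := by
  refine (rk_isLUB T hx).2 ?_
  rintro _ ⟨z, hz, rfl⟩
  exact h z hz.1 hz.2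

theorem rk_nonneg (T : Lob E) {x : E} (hx : 0 ≤ x) : 0 ≤ rk T x := by
  simpa using le_rk T le_rfl hx

theorem rk_add (T : Lob E) {x y : E} (hx : 0 ≤ x) (hy : 0 ≤ y) :
    rk T (x + y) = rk T x + rk T y := by
  apply le_antisymm
  · refine rk_le T (add_nonneg hx hy) fun z hz hzxy => ?_
    have h1 : T.1 (z ⊓ x) ≤ rk T x := le_rk T (le_inf hz hx) inf_le_right
    have h2 : T.1 (z - z ⊓ x) ≤ rk T y := by
      refine le_rk T (sub_nonneg.2 inf_le_left) ?_
      rw [sub_le_comm]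
      exact le_inf (sub_le_self z hy) (sub_le_iff_le_add.2 hzxy)
    calc T.1 z = T.1 (z ⊓ x) + T.1 (z - z ⊓ x) := by rw [← map_add]; simp
      _ ≤ _ := add_le_add h1 h2
  · rw [← le_sub_iff_add_le]
    refine rk_le T hx fun z hz hzx => ?_
    rw [le_sub_comm]
    refine rk_le T hy fun w hw hwy => ?_
    rw [le_sub_iff_add_le, ← map_add, add_comm]
    exact le_rk T (add_nonneg hz hw) (add_le_add hzx hwy)

theorem rk_smul_le (T : Lob E) {r : ℝ} (hr : 0 < r) {x : E} (hx : 0 ≤ x) :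
    rk T (r • x) ≤ r • rk T x := by
  refine rk_le T (smul_nonneg hr.le hx) fun z hz hzx => ?_
  have h1 : T.1 (r⁻¹ • z) ≤ rk T x :=
    le_rk T (smul_nonneg (inv_nonneg.2 hr.le) hz) ((inv_smul_le_iff_of_pos hr).2 hzx)
  rw [map_smul] at h1
  exact (inv_smul_le_iff_of_pos hr).1 h1

theorem rk_smul (T : Lob E) {r : ℝ} (hr : 0 ≤ r) {x : E} (hx : 0 ≤ x) :
    rk T (r • x) = r • rk T x := by
  rcases hr.eq_or_lt with rfl | hr
  · have := rk_add T (le_refl (0 : E)) le_rfl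
    simpa using this
  · refine le_antisymm (rk_smul_le T hr hx) ?_
    have h := rk_smul_le T (inv_pos.2 hr) (smul_nonneg hr.le hx)
    rw [inv_smul_smul₀ hr.ne'] at h
    exact (le_inv_smul_iff_of_pos hr).1 h

theorem rk_sub (T : Lob E) {x a b : E} (ha : 0 ≤ a) (hb : 0 ≤ b) (h : x = a - b) :
    rk T x⁺ - rk T x⁻ = rk T a - rk T b := by
  rw [sub_eq_sub_iff_add_eq_add, ← rk_add T (posPart_nonneg x) hb,
    ← rk_add T ha (negPart_nonneg x), ← sub_eq_sub_iff_add_eq_add.1]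
  rw [posPart_sub_negPart, h]

/-- The positive part of an order bounded operator. -/
noncomputable def Lob.posOp (T : Lob E) : Lob E :=
  ⟨{ toFun := fun x => rk T x⁺ - rk T x⁻
     map_add' := by
      intro x y
      rw [rk_sub T (add_nonneg (posPart_nonneg x) (posPart_nonneg y))
        (add_nonneg (negPart_nonneg x) (negPart_nonneg y)),
        rk_add T (posPart_nonneg x) (posPart_nonneg y),
        rk_add T (negPart_nonneg x) (negPart_nonneg y)]
      · abel
      · conv_lhs => rw [← posPart_sub_negPart x, ← posPart_sub_negPart y]
        abel
     map_smul' := by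
      intro r x
      rcases le_total 0 r with hr | hr
      · rw [rk_sub T (smul_nonneg hr (posPart_nonneg x)) (smul_nonneg hr (negPart_nonneg x)),
          rk_smul T hr (posPart_nonneg x), rk_smul T hr (negPart_nonneg x), ← smul_sub]
        · rfl
        · rw [← smul_sub, posPart_sub_negPart]
      · have hr' : 0 ≤ -r := neg_nonneg.2 hr
        rw [rk_sub T (smul_nonneg hr' (negPart_nonneg x)) (smul_nonneg hr' (posPart_nonneg x)),
          rk_smul T hr' (posPart_nonneg x), rk_smul T hr' (negPart_nonneg x), ← smul_sub]
        · simp only [neg_smul, RingHom.id_apply, smul_sub]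
          abel
        · rw [← smul_sub, neg_smul, ← smul_neg, neg_sub, posPart_sub_negPart] }, by
    have key : ∀ x y : E, x ≤ y → rk T x⁺ - rk T x⁻ ≤ rk T y⁺ - rk T y⁻ := by
      intro x y hxy
      have h := rk_sub T (x := y) (a := x⁺ + (y - x)) (b := x⁻)
        (add_nonneg (posPart_nonneg x) (sub_nonneg.2 hxy)) (negPart_nonneg x) (by
          rw [add_sub_right_comm, posPart_sub_negPart]; abel)
      rw [h, rk_add T (posPart_nonneg x) (sub_nonneg.2 hxy)]
      exact sub_le_sub_right (le_add_of_nonneg_right (rk_nonneg T (sub_nonneg.2 hxy))) _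
    intro a b
    refine ⟨rk T a⁺ - rk T a⁻, rk T b⁺ - rk T b⁻, ?_⟩
    rintro _ ⟨x, hx, rfl⟩
    exact ⟨key a x hx.1, key x b hx.2⟩⟩

theorem Lob.posOp_apply (T : Lob E) {x : E} (hx : 0 ≤ x) : (Lob.posOp T).1 x = rk T x := by
  have h := rk_sub T hx le_rfl (sub_zero x).symm
  have h0 : rk T 0 = 0 := by simpa using rk_add T (le_refl (0 : E)) le_rfl
  rw [h0, sub_zero] at h
  exact h

theorem Lob.le_posOp (T : Lob E) : T ≤ Lob.posOp T := fun x hx => by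
  rw [Lob.posOp_apply T hx]; exact le_rk T hx le_rfl

theorem Lob.posOp_nonneg (T : Lob E) : 0 ≤ Lob.posOp T := fun x hx => by
  rw [Lob.posOp_apply T hx]; exact rk_nonneg T hx

theorem Lob.posOp_le {T S : Lob E} (h : T ≤ S) (h0 : 0 ≤ S) : Lob.posOp T ≤ S := fun x hx => by
  rw [Lob.posOp_apply T hx]
  refine rk_le T hx fun z hz hzx => (h z hz).trans ?_
  have := h0 (x - z) (sub_nonneg.2 hzx)
  rw [map_sub] at this
  exact sub_nonneg.1 (by simpa using this)

/-- The vector lattice of order bounded operators on a Dedekind complete vector lattice, with the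
operator order: `S ⊔ T = (S - T)⁺ + T` and `S ⊓ T = S - (S - T)⁺`. -/
noncomputable instance : Lattice (Lob E) where
  sup S T := Lob.posOp (S - T) + T
  le_sup_left S T := sub_le_iff_le_add.1 (Lob.le_posOp (S - T))
  le_sup_right S T := le_add_of_nonneg_left (Lob.posOp_nonneg (S - T))
  sup_le _ T _ h h' :=
    le_sub_iff_add_le.1 (Lob.posOp_le (sub_le_sub_right h T) (sub_nonneg.2 h'))
  inf S T := S - Lob.posOp (S - T)
  inf_le_left S T := sub_le_self S (Lob.posOp_nonneg (S - T))
  inf_le_right S T := sub_le_comm.1 (Lob.le_posOp (S - T))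
  le_inf _ S _ h h' :=
    le_sub_comm.1 (Lob.posOp_le (sub_le_sub_left h' S) (sub_nonneg.2 h))

variable (E) in
/-- The orthomorphisms on `E`: the band preserving order bounded operators. -/
def Orth : Submodule ℝ (Lob E) where
  carrier := {T | IsBandPreserving T.1}
  add_mem' := fun hS hT B hB x hx => B.add_mem (hS B hB x hx) (hT B hB x hx)
  zero_mem' := fun B _ _ _ => B.zero_mem
  smul_mem' := fun r _ hT B hB x hx => B.smul_mem r (hT B hB x hx)

theorem Orth.posOp_mem {T : Lob E} (hT : T ∈ Orth E) : Lob.posOp T ∈ Orth E := by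
  intro B hB x hx
  have key : ∀ y ∈ B, 0 ≤ y → (Lob.posOp T).1 y ∈ B := by
    intro y hy hy0
    rw [Lob.posOp_apply T hy0]
    refine hB.isLUB_mem _ _ ?_ (rk_isLUB T hy0)
    rintro _ ⟨z, hz, rfl⟩
    exact hT B hB z (hB.solid hy (by rw [abs_of_nonneg hz.1, abs_of_nonneg hy0]; exact hz.2))
  have h1 : x⁺ ∈ B := hB.solid hx (by
    rw [abs_of_nonneg (posPart_nonneg x), ← posPart_add_negPart x]
    exact le_add_of_nonneg_right (negPart_nonneg x))
  have h2 : x⁻ ∈ B := hB.solid hx (by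
    rw [abs_of_nonneg (negPart_nonneg x), ← posPart_add_negPart x]
    exact le_add_of_nonneg_left (posPart_nonneg x))
  rw [← posPart_sub_negPart x, map_sub]
  exact B.sub_mem (key _ h1 (posPart_nonneg x)) (key _ h2 (negPart_nonneg x))

/-- `Orth E` is a vector sublattice of `Lob E`, with the restricted order and operations. -/
noncomputable instance : Lattice (Orth E) :=
  Subtype.lattice
    (fun _ _ hS hT => (Orth E).add_mem (Orth.posOp_mem ((Orth E).sub_mem hS hT)) hT)
    (fun _ _ hS hT => (Orth E).sub_mem hS (Orth.posOp_mem ((Orth E).sub_mem hS hT)))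

end Lattice

end VectorLattice

/-!
The proof rests on the fact that an orthomorphism `T` acts like multiplication by a function:
`|T| |x| = |T x|` for all `x` (`Orth.abs_apply_abs`). This comes from `Orth.posPart_inf_negPart`,
which says that `(T x)⁺` and `(T y)⁻` are disjoint for `x, y ≥ 0`. The latter is proved without a
spectral theorem, by cutting `x` along the multiples `k • y`: band preservation keeps the image of
each of `(x - k • y)⁺` and `(x - k • y)⁻` disjoint from the other one, order boundedness controls
the error between two consecutive cuts, and the Archimedean property removes it.

As a consequence, suprema of bounded families of positive orthomorphisms are pointwise
(`Orth.exists_isLUB`), so that the operators `Z β = ⨆ α ≥ β, |T α|` exist in `Orth E`. If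
`T α s → 0` for all `s ∈ S`, then every positive orthomorphism `R` below all `Z β` vanishes on `S`.
The kernel of a positive orthomorphism is a band (`Orth.isBand_ker`), hence `R = 0`, so `Z` decreases
to `0` and `T → 0` in `Orth E`. Convergence in `Orth E` yields convergence in `Lob E` because
`Orth E` is an ideal of `Lob E` (`Orth.isGLB_coe`), and convergence in `Lob E` yields
pointwise convergence because infima of decreasing nets of positive operators are pointwise (`Lob.isGLB_apply`).
-/

namespace VectorLattice

universe u v

/-! ### Disjointness -/

section Disjoint

variable {E : Type u} [AddCommGroup E] [Lattice E]

theorem inf_eq_zero_of_le {a b c : E} (hb : 0 ≤ b) (hc : 0 ≤ c) (h : a ⊓ c = 0) (hbc : b ≤ a) :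
    b ⊓ c = 0 :=
  le_antisymm ((inf_le_inf_right c hbc).trans h.le) (le_inf hb hc)

variable [IsOrderedAddMonoid E]

theorem eq_zero_of_abs_nonpos {x : E} (h : |x| ≤ 0) : x = 0 :=
  le_antisymm ((le_abs_self x).trans h) (neg_nonpos.1 ((neg_le_abs x).trans h))

theorem le_of_le_add_of_inf_eq_zero {z a b : E} (ha : 0 ≤ a) (h : z ≤ a + b) (hb : z ⊓ b = 0) :
    z ≤ a := by
  have h1 : z - a ≤ z ⊓ b := le_inf (sub_le_self z ha) (sub_le_iff_le_add'.2 h)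
  rw [hb] at h1
  exact sub_nonpos.1 h1

theorem add_inf_eq_zero {a b c : E} (ha : 0 ≤ a) (hb : 0 ≤ b) (hc : 0 ≤ c) (hac : a ⊓ c = 0)
    (hbc : b ⊓ c = 0) : (a + b) ⊓ c = 0 := by
  have h0 : 0 ≤ (a + b) ⊓ c := le_inf (add_nonneg ha hb) hc
  have h1 : (a + b) ⊓ c ≤ a := by
    refine le_of_le_add_of_inf_eq_zero ha inf_le_left ?_
    rw [inf_comm b c] at hbc
    exact inf_eq_zero_of_le h0 hb hbc inf_le_right
  exact le_antisymm ((le_inf h1 inf_le_right).trans hac.le) h0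

theorem nsmul_inf_eq_zero {a c : E} (ha : 0 ≤ a) (hc : 0 ≤ c) (h : a ⊓ c = 0) (n : ℕ) :
    (n • a) ⊓ c = 0 := by
  induction n with
  | zero => simpa using hc
  | succ n ih =>
    rw [succ_nsmul]
    exact add_inf_eq_zero (nsmul_nonneg ha n) ha hc ih h

theorem posPart_le_abs' (x : E) : x⁺ ≤ |x| := by
  rw [← posPart_add_negPart x]
  exact le_add_of_nonneg_right (negPart_nonneg x)

theorem negPart_le_abs' (x : E) : x⁻ ≤ |x| := by
  rw [← posPart_add_negPart x]
  exact le_add_of_nonneg_left (posPart_nonneg x)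

variable [Module ℝ E] [IsOrderedModule ℝ E]

theorem abs_smul_le_nsmul (r : ℝ) (x : E) : ∃ n : ℕ, |r • x| ≤ n • |x| := by
  obtain ⟨n, hn⟩ := exists_nat_ge |r|
  refine ⟨n, ?_⟩
  have h2 : |r| • |x| ≤ n • |x| := by
    rw [← Nat.cast_smul_eq_nsmul ℝ]
    exact smul_le_smul_of_nonneg_right hn (abs_nonneg x)
  refine le_trans ?_ h2
  rcases le_total 0 r with hr | hr
  · rw [abs_of_nonneg hr]
    refine abs_le'.2 ⟨smul_le_smul_of_nonneg_left (le_abs_self x) hr, ?_⟩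
    rw [← smul_neg]
    exact smul_le_smul_of_nonneg_left (neg_le_abs x) hr
  · rw [abs_of_nonpos hr]
    have hr' : 0 ≤ -r := neg_nonneg.2 hr
    refine abs_le'.2 ⟨?_, ?_⟩
    · rw [← neg_smul_neg]
      exact smul_le_smul_of_nonneg_left (neg_le_abs x) hr'
    · rw [← neg_smul]
      exact smul_le_smul_of_nonneg_left (le_abs_self x) hr'

/-- The disjoint complement of a single element `a`: all `x` with `|x| ⊓ |a| = 0`. -/
def disjointCompl (a : E) : Submodule ℝ E where
  carrier := {x | |x| ⊓ |a| = 0}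
  add_mem' := fun {x y} hx hy =>
    inf_eq_zero_of_le (abs_nonneg _) (abs_nonneg _)
      (add_inf_eq_zero (abs_nonneg x) (abs_nonneg y) (abs_nonneg a) hx hy) (abs_add_le x y)
  zero_mem' := by simp
  smul_mem' := fun r x hx => by
    obtain ⟨n, hn⟩ := abs_smul_le_nsmul r x
    exact inf_eq_zero_of_le (abs_nonneg _) (abs_nonneg _)
      (nsmul_inf_eq_zero (abs_nonneg x) (abs_nonneg a) hx n) hn

theorem mem_disjointCompl {a x : E} : x ∈ disjointCompl a ↔ |x| ⊓ |a| = 0 := Iff.rfl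

theorem mem_disjointCompl_comm {a x : E} : x ∈ disjointCompl a ↔ a ∈ disjointCompl x := by
  rw [mem_disjointCompl, mem_disjointCompl, inf_comm]

theorem mem_disjointCompl_of_abs_le {a x y : E} (hx : x ∈ disjointCompl a) (h : |y| ≤ |x|) :
    y ∈ disjointCompl a :=
  inf_eq_zero_of_le (abs_nonneg _) (abs_nonneg _) hx h

theorem mem_disjointCompl_of_le {a x y : E} (hx : x ∈ disjointCompl a) (hy : 0 ≤ y)
    (h : y ≤ |x|) : y ∈ disjointCompl a :=
  mem_disjointCompl_of_abs_le hx (by rwa [abs_of_nonneg hy])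

theorem abs_mem_disjointCompl {a x : E} (hx : x ∈ disjointCompl a) : |x| ∈ disjointCompl a :=
  mem_disjointCompl_of_le hx (abs_nonneg x) le_rfl

theorem eq_zero_of_mem_disjointCompl_self {x : E} (hx : x ∈ disjointCompl x) : x = 0 := by
  rw [mem_disjointCompl, inf_idem] at hx
  exact eq_zero_of_abs_nonpos hx.le

theorem le_of_le_add_of_mem_disjointCompl {z a b : E} (hz : 0 ≤ z) (ha : 0 ≤ a) (hb : 0 ≤ b)
    (h : z ≤ a + b) (hzb : b ∈ disjointCompl z) : z ≤ a := by
  refine le_of_le_add_of_inf_eq_zero ha h ?_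
  rwa [mem_disjointCompl, abs_of_nonneg hz, abs_of_nonneg hb, inf_comm] at hzb

theorem abs_sub_eq_of_mem_disjointCompl {a b : E} (h : a ∈ disjointCompl b) :
    |a - b| = |a| + |b| := by
  have h' : |a| ⊓ |b| = 0 := h
  refine le_antisymm ?_ ?_
  · rw [sub_eq_add_neg, ← abs_neg b]
    exact abs_add_le _ _
  · rw [← inf_add_sup |a| |b|, h', zero_add]
    refine sup_le (le_of_le_add_of_inf_eq_zero (abs_nonneg _) ?_ h')
      (le_of_le_add_of_inf_eq_zero (abs_nonneg _) ?_ (by rwa [inf_comm]))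
    · simpa using abs_add_le (a - b) b
    · rw [abs_sub_comm]
      simpa using abs_add_le (b - a) a

theorem posPart_mem_disjointCompl_negPart (x : E) : x⁺ ∈ disjointCompl x⁻ := by
  rw [mem_disjointCompl, abs_of_nonneg (posPart_nonneg x), abs_of_nonneg (negPart_nonneg x)]
  exact posPart_inf_negPart_eq_zero x

theorem isBand_disjointCompl (a : E) : IsBand (disjointCompl a) where
  solid := fun _ hx _ h => mem_disjointCompl_of_abs_le hx h
  isLUB_mem := by
    intro s x hs hx
    have hpos : x⁺ ∈ disjointCompl a := by
      -- The overlap `w` of `x⁺` and `|a|` is disjoint from `s`, so `x⁺ - w` still bounds `s`.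
      set w := x⁺ ⊓ |a| with hw
      have hw0 : 0 ≤ w := le_inf (posPart_nonneg x) (abs_nonneg a)
      have hnn : 0 ≤ x⁺ - w := sub_nonneg.2 inf_le_left
      have hub : x ≤ x⁺ - w := by
        refine hx.2 fun t ht => ?_
        have h1 : t⁺ ⊓ w = 0 := by
          have h2 : t⁺ ⊓ |a| = 0 :=
            inf_eq_zero_of_le (posPart_nonneg t) (abs_nonneg a) (hs ht) (posPart_le_abs' t)
          exact le_antisymm ((inf_le_inf_left _ inf_le_right).trans h2.le)
            (le_inf (posPart_nonneg t) hw0)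
        have h3 : t⁺ + w ≤ x⁺ := by
          rw [← inf_add_sup t⁺ w, h1, zero_add]
          exact sup_le (posPart_mono (hx.1 ht)) inf_le_left
        exact (le_posPart t).trans (le_sub_iff_add_le.2 h3)
      have h4 : x⁺ ≤ x⁺ - w := sup_le hub hnn
      have h5 : w = 0 := le_antisymm (by simpa using h4) hw0
      rw [mem_disjointCompl, abs_of_nonneg (posPart_nonneg x)]
      exact h5
    rcases s.eq_empty_or_nonempty with rfl | ⟨t, ht⟩
    · -- A supremum `x` of `∅` is a least element, which forces `x = 0`.
      have h6 : x ≤ x + x := hx.2 (by simp)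
      have h7 : x ≤ 0 := hx.2 (by simp)
      have : x = 0 := le_antisymm h7 (by simpa using h6)
      rw [this]
      exact Submodule.zero_mem _
    · have hneg : x⁻ ∈ disjointCompl a :=
        mem_disjointCompl_of_le (hs ht) (negPart_nonneg x)
          ((negPart_anti (hx.1 ht)).trans (negPart_le_abs' t))
      rw [← posPart_sub_negPart x]
      exact Submodule.sub_mem _ hpos hneg

end Disjoint

section Complete

variable {E : Type u} [AddCommGroup E] [ConditionallyCompleteLattice E] [IsOrderedAddMonoid E]

/-- A Dedekind complete vector lattice is Archimedean. -/
theorem nonpos_of_forall_nsmul_le {w x : E} (h : ∀ n : ℕ, n • w ≤ x) : w ≤ 0 := by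
  have hlub : IsLUB (Set.range fun n : ℕ => n • w) (sSup (Set.range fun n : ℕ => n • w)) :=
    isLUB_csSup (Set.range_nonempty _) ⟨x, by rintro _ ⟨n, rfl⟩; exact h n⟩
  have h2 : sSup (Set.range fun n : ℕ => n • w) ≤ sSup (Set.range fun n : ℕ => n • w) - w := by
    refine hlub.2 ?_
    rintro _ ⟨n, rfl⟩
    rw [le_sub_iff_add_le]
    exact hlub.1 ⟨n + 1, succ_nsmul w n⟩
  simpa using h2

variable [Module ℝ E] [IsOrderedModule ℝ E]

theorem mem_disjointCompl_of_forall_posPart {a x y : E} (hx : 0 ≤ x) (hy : 0 ≤ y)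
    (h : ∀ k : ℕ, (k • y - x)⁺ ∈ disjointCompl a) : y ∈ disjointCompl a := by
  have hw0 : 0 ≤ y ⊓ |a| := le_inf hy (abs_nonneg a)
  have hw : y ⊓ |a| ≤ 0 := by
    refine nonpos_of_forall_nsmul_le (x := x) fun k => ?_
    refine le_of_le_add_of_mem_disjointCompl (nsmul_nonneg hw0 k) hx (posPart_nonneg (k • y - x))
      ?_ ?_
    · rw [← sub_le_iff_le_add']
      exact (sub_le_sub_right (nsmul_le_nsmul_right inf_le_left k) x).trans (le_posPart _)
    · have h1 := mem_disjointCompl_comm.1 (h k)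
      exact mem_disjointCompl_comm.1
        (nsmul_mem (mem_disjointCompl_of_le h1 hw0 inf_le_right) k)
  rw [mem_disjointCompl, abs_of_nonneg hy]
  exact le_antisymm hw hw0

/-! ### Orthomorphisms act pointwise -/

theorem Orth.apply_mem_disjointCompl {T : Lob E} (hT : T ∈ Orth E) {a x : E}
    (hx : x ∈ disjointCompl a) : T.1 x ∈ disjointCompl a :=
  hT _ (isBand_disjointCompl a) x hx

/-- The induction behind `Orth.posPart_inf_negPart`: passing from the cut of `x` at `k • y` to the
cut at `(k + 1) • y` costs at most `P y`, and the rest of `z` is then disjoint from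
`((k + 1) • y - x)⁺`. -/
theorem Orth.le_of_forall_le_abs_sub {T P : Lob E} (hT : T ∈ Orth E)
    (hP : ∀ w, 0 ≤ w → |T.1 w| ≤ P.1 w) {x y z : E} (hx : 0 ≤ x) (hy : 0 ≤ y) (n : ℕ)
    (hzy : z ≤ n • |T.1 y|) (h : ∀ k : ℕ, z ≤ |T.1 x - k • T.1 y|) : z ≤ P.1 y := by
  have hP0 : ∀ w, 0 ≤ w → 0 ≤ P.1 w := fun w hw => (abs_nonneg _).trans (hP w hw)
  set z' := (z - P.1 y)⁺ with hz'
  have hz'0 : 0 ≤ z' := posPart_nonneg _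
  have key : ∀ k : ℕ, (k • y - x)⁺ ∈ disjointCompl z' := by
    intro k
    induction k with
    | zero =>
      have : (0 • y - x)⁺ = 0 := by rw [zero_smul, zero_sub, posPart_eq_zero]; simpa using hx
      rw [this]
      exact Submodule.zero_mem _
    | succ k ih =>
      set v := (k • y - x)⁺
      set w := (k • y - x)⁻
      set v' := ((k + 1) • y - x)⁺
      set w' := ((k + 1) • y - x)⁻
      have e1 : v - w = k • y - x := posPart_sub_negPart _
      have hle : k • y - x ≤ (k + 1) • y - x := by
        rw [succ_nsmul]
        exact sub_le_sub_right (le_add_of_nonneg_right hy) x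
      have hd0 : 0 ≤ w - w' := sub_nonneg.2 (negPart_anti hle)
      have hdy : w - w' ≤ y := by
        rw [sub_le_iff_le_add]
        refine sup_le ?_ (add_nonneg hy (negPart_nonneg _))
        have h1 : -((k + 1) • y - x) ≤ w' := neg_le_negPart _
        calc -(k • y - x) = y + -((k + 1) • y - x) := by rw [succ_nsmul]; abel
          _ ≤ y + w' := by gcongr
      have hPd : P.1 (w - w') ≤ P.1 y := by
        have := hP0 _ (sub_nonneg.2 hdy)
        rwa [map_sub, sub_nonneg] at this
      have e2 : T.1 x - k • T.1 y = T.1 w' + T.1 (w - w') + - T.1 v := by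
        rw [← map_nsmul, ← map_sub, ← map_neg, ← map_add, ← map_add]
        congr 1
        have : x - k • y = w - v := by rw [← neg_sub v w, e1, neg_sub]
        rw [this]
        abel
      have h2 : z ≤ |T.1 w'| + P.1 y + |T.1 v| := by
        refine (h k).trans ?_
        rw [e2]
        refine (abs_add_le _ _).trans ?_
        rw [abs_neg]
        gcongr
        refine (abs_add_le _ _).trans ?_
        gcongr
        exact (hP _ hd0).trans hPd
      have h3 : z' ≤ |T.1 w'| + |T.1 v| := by
        refine sup_le ?_ (add_nonneg (abs_nonneg _) (abs_nonneg _))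
        rw [sub_le_iff_le_add]
        refine h2.trans (le_of_eq ?_)
        abel
      have h4 : z' ≤ |T.1 w'| :=
        le_of_le_add_of_mem_disjointCompl hz'0 (abs_nonneg _) (abs_nonneg _) h3
          (abs_mem_disjointCompl (Orth.apply_mem_disjointCompl hT ih))
      have h5 : w' ∈ disjointCompl v' :=
        mem_disjointCompl_comm.1 (posPart_mem_disjointCompl_negPart _)
      exact mem_disjointCompl_comm.1
        (mem_disjointCompl_of_le (Orth.apply_mem_disjointCompl hT h5) hz'0 h4)
  have hTy : n • |T.1 y| ∈ disjointCompl z' :=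
    nsmul_mem (abs_mem_disjointCompl
      (Orth.apply_mem_disjointCompl hT (mem_disjointCompl_of_forall_posPart hx hy key))) n
  have hz'z : z' ≤ n • |T.1 y| :=
    sup_le ((sub_le_self z (hP0 y hy)).trans hzy) (nsmul_nonneg (abs_nonneg _) n)
  have hz'' : z' = 0 := eq_zero_of_mem_disjointCompl_self
    (mem_disjointCompl_of_le hTy hz'0 (hz'z.trans (le_abs_self _)))
  rw [hz', posPart_eq_zero] at hz''
  exact sub_nonpos.1 hz''

theorem Lob.abs_apply_le (T : Lob E) {w : E} (hw : 0 ≤ w) : |T.1 w| ≤ (|T|).1 w :=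
  abs_le'.2 ⟨(le_abs_self T) w hw, (neg_le_abs T) w hw⟩

theorem Orth.posPart_inf_negPart {T : Lob E} (hT : T ∈ Orth E) {x y : E} (hx : 0 ≤ x)
    (hy : 0 ≤ y) : (T.1 x)⁺ ⊓ (T.1 y)⁻ = 0 := by
  set z := (T.1 x)⁺ ⊓ (T.1 y)⁻ with hz
  have hz0 : 0 ≤ z := le_inf (posPart_nonneg _) (negPart_nonneg _)
  refine le_antisymm ?_ hz0
  refine nonpos_of_forall_nsmul_le (x := (|T|).1 y) fun n => ?_
  refine Orth.le_of_forall_le_abs_sub hT (fun w hw => Lob.abs_apply_le T hw)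
    (nsmul_nonneg hx n) hy n (nsmul_le_nsmul_right (inf_le_right.trans (negPart_le_abs' _)) n)
    fun k => ?_
  have hzx : (T.1 x)⁻ ∈ disjointCompl z := mem_disjointCompl_comm.1
    (mem_disjointCompl_of_le (posPart_mem_disjointCompl_negPart (T.1 x)) hz0
      (inf_le_left.trans (le_abs_self _)))
  have hzy : (T.1 y)⁺ ∈ disjointCompl z := mem_disjointCompl_comm.1
    (mem_disjointCompl_of_le (mem_disjointCompl_comm.1 (posPart_mem_disjointCompl_negPart (T.1 y)))
      hz0 (inf_le_right.trans (le_abs_self _)))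
  refine le_of_le_add_of_mem_disjointCompl (b := n • (T.1 x)⁻ + k • (T.1 y)⁺)
    (nsmul_nonneg hz0 n) (abs_nonneg _)
    (add_nonneg (nsmul_nonneg (negPart_nonneg _) n) (nsmul_nonneg (posPart_nonneg _) k)) ?_ ?_
  · calc n • z ≤ n • (T.1 x)⁺ := nsmul_le_nsmul_right inf_le_left n
      _ ≤ n • (T.1 x)⁺ + k • (T.1 y)⁻ :=
        le_add_of_nonneg_right (nsmul_nonneg (negPart_nonneg _) k)
      _ = (n • ((T.1 x)⁺ - (T.1 x)⁻) - k • ((T.1 y)⁺ - (T.1 y)⁻))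
          + (n • (T.1 x)⁻ + k • (T.1 y)⁺) := by
        rw [nsmul_sub, nsmul_sub]; abel
      _ ≤ _ := by
        rw [posPart_sub_negPart, posPart_sub_negPart, map_nsmul]
        gcongr
        exact le_abs_self _
  · have h1 : n • (T.1 x)⁻ + k • (T.1 y)⁺ ∈ disjointCompl z :=
      add_mem (nsmul_mem hzx n) (nsmul_mem hzy k)
    exact mem_disjointCompl_comm.1 (nsmul_mem (mem_disjointCompl_comm.1 h1) n)

/-- The positive part of an orthomorphism is computed pointwise on the positive cone. -/
theorem Orth.posOp_apply {T : Lob E} (hT : T ∈ Orth E) {x : E} (hx : 0 ≤ x) :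
    (Lob.posOp T).1 x = (T.1 x)⁺ := by
  refine le_antisymm ?_ (sup_le (Lob.le_posOp T x hx) (Lob.posOp_nonneg T x hx))
  rw [Lob.posOp_apply T hx]
  refine rk_le T hx fun z hz hzx => (le_posPart _).trans ?_
  have hxz : 0 ≤ x - z := sub_nonneg.2 hzx
  refine le_of_le_add_of_inf_eq_zero (b := (T.1 (x - z))⁻ + (T.1 z)⁻) (posPart_nonneg _) ?_ ?_
  · calc (T.1 z)⁺ = T.1 z + (T.1 z)⁻ := sub_eq_iff_eq_add.1 (posPart_sub_negPart _)
      _ = T.1 x + (-T.1 (x - z) + (T.1 z)⁻) := by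
          rw [map_sub]
          abel
      _ ≤ _ := by
        gcongr
        · exact le_posPart _
        · exact neg_le_negPart _
  · rw [inf_comm]
    refine add_inf_eq_zero (negPart_nonneg _) (negPart_nonneg _) (posPart_nonneg _) ?_ ?_
    · rw [inf_comm]; exact Orth.posPart_inf_negPart hT hz hxz
    · rw [inf_comm]; exact Orth.posPart_inf_negPart hT hz hz

theorem Orth.sup_apply {S T : Lob E} (hS : S ∈ Orth E) (hT : T ∈ Orth E) {x : E} (hx : 0 ≤ x) :
    (S ⊔ T).1 x = S.1 x ⊔ T.1 x := by
  change (Lob.posOp (S - T)).1 x + T.1 x = _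
  rw [Orth.posOp_apply ((Orth E).sub_mem hS hT) hx]
  change (S.1 x - T.1 x)⁺ + T.1 x = _
  rw [posPart_def, sup_add, sub_add_cancel, zero_add]

theorem Orth.abs_apply {T : Lob E} (hT : T ∈ Orth E) {x : E} (hx : 0 ≤ x) :
    (|T|).1 x = |T.1 x| :=
  Orth.sup_apply hT ((Orth E).neg_mem hT) hx

theorem Orth.abs_apply_abs {T : Lob E} (hT : T ∈ Orth E) (x : E) : (|T|).1 |x| = |T.1 x| := by
  have hd : T.1 x⁺ ∈ disjointCompl (T.1 x⁻) :=
    Orth.apply_mem_disjointCompl hT (mem_disjointCompl_comm.1 (Orth.apply_mem_disjointCompl hT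
      (mem_disjointCompl_comm.1 (posPart_mem_disjointCompl_negPart x))))
  rw [← posPart_add_negPart x, map_add, Orth.abs_apply hT (posPart_nonneg x),
    Orth.abs_apply hT (negPart_nonneg x)]
  conv_rhs => rw [← posPart_sub_negPart x, map_sub]
  exact (abs_sub_eq_of_mem_disjointCompl hd).symm

theorem Lob.apply_nonneg {R : Lob E} (hR : 0 ≤ R) {x : E} (hx : 0 ≤ x) : 0 ≤ R.1 x := hR x hx

theorem Lob.apply_mono {R : Lob E} (hR : 0 ≤ R) {x y : E} (h : x ≤ y) : R.1 x ≤ R.1 y := by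
  have := Lob.apply_nonneg hR (sub_nonneg.2 h)
  rwa [map_sub, sub_nonneg] at this

theorem Orth.apply_abs_of_nonneg {R : Lob E} (hR : R ∈ Orth E) (hR0 : 0 ≤ R) (x : E) :
    R.1 |x| = |R.1 x| := by
  have h := Orth.abs_apply_abs hR x
  rwa [abs_of_nonneg hR0] at h

/-- The kernel of a positive orthomorphism is contained in the disjoint complement of the range. -/
theorem Orth.mem_disjointCompl_of_apply_eq_zero {R : Lob E} (hR : R ∈ Orth E) (hR0 : 0 ≤ R)
    {x : E} (hx : R.1 x = 0) (y : E) : x ∈ disjointCompl (R.1 y) := by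
  have hx' : R.1 |x| = 0 := by rw [Orth.apply_abs_of_nonneg hR hR0, hx, abs_zero]
  suffices h : |x| ∈ disjointCompl (R.1 y) from
    mem_disjointCompl_of_abs_le h (le_abs_self _)
  refine mem_disjointCompl_of_forall_posPart (abs_nonneg y) (abs_nonneg x) fun k => ?_
  -- As `R x = 0`, the value `R |y|` is at most `R` of the part of `|y|` above `k • |x|`.
  have h1 : |R.1 y| ≤ R.1 (k • |x| - |y|)⁻ := by
    calc |R.1 y| = R.1 (-(k • |x| - |y|)) := by
          rw [neg_sub, map_sub, map_nsmul, hx', smul_zero, sub_zero,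
            Orth.apply_abs_of_nonneg hR hR0]
      _ ≤ _ := Lob.apply_mono hR0 (neg_le_negPart _)
  exact mem_disjointCompl_comm.1 (mem_disjointCompl_of_abs_le
    (Orth.apply_mem_disjointCompl hR
      (mem_disjointCompl_comm.1 (posPart_mem_disjointCompl_negPart _)))
    (h1.trans (le_abs_self _)))

theorem Orth.isBand_ker {R : Lob E} (hR : R ∈ Orth E) (hR0 : 0 ≤ R) :
    IsBand (LinearMap.ker R.1) where
  solid := by
    intro x hx y hyx
    have hx' : R.1 x = 0 := hx
    have h2 : |R.1 y| ≤ 0 := by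
      rw [← Orth.apply_abs_of_nonneg hR hR0, ← abs_zero (α := E), ← hx',
        ← Orth.apply_abs_of_nonneg hR hR0]
      exact Lob.apply_mono hR0 hyx
    exact eq_zero_of_abs_nonpos h2
  isLUB_mem := by
    intro s x hs hx
    have h : x ∈ disjointCompl (R.1 x) := (isBand_disjointCompl (R.1 x)).isLUB_mem s x
      (fun t ht => Orth.mem_disjointCompl_of_apply_eq_zero hR hR0 (hs ht) x) hx
    exact eq_zero_of_mem_disjointCompl_self (Orth.apply_mem_disjointCompl hR h)

/-! ### Pointwise suprema and infima of operators -/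

/-- A positive, additive and positively homogeneous map on the positive cone extends to a positive
operator. For homogeneity one inequality suffices, as the scalar can be inverted. -/
theorem exists_lob_of_additive (f : E → E)
    (hadd : ∀ x y, 0 ≤ x → 0 ≤ y → f (x + y) = f x + f y)
    (hsmul : ∀ (r : ℝ) x, 0 < r → 0 ≤ x → f (r • x) ≤ r • f x)
    (hnn : ∀ x, 0 ≤ x → 0 ≤ f x) :
    ∃ R : Lob E, ∀ x, 0 ≤ x → R.1 x = f x := by
  have f0 : f 0 = 0 := by simpa using hadd 0 0 le_rfl le_rfl
  have hsmul' : ∀ (r : ℝ) x, 0 ≤ r → 0 ≤ x → f (r • x) = r • f x := by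
    intro r x hr hx
    rcases hr.eq_or_lt with rfl | hr
    · simpa using f0
    · refine le_antisymm (hsmul r x hr hx) ?_
      have h := hsmul r⁻¹ _ (inv_pos.2 hr) (smul_nonneg hr.le hx)
      rw [inv_smul_smul₀ hr.ne'] at h
      exact (le_inv_smul_iff_of_pos hr).1 h
  have hsub : ∀ x a b, 0 ≤ a → 0 ≤ b → x = a - b → f x⁺ - f x⁻ = f a - f b := by
    intro x a b ha hb h
    rw [sub_eq_sub_iff_add_eq_add, ← hadd _ _ (posPart_nonneg x) hb,
      ← hadd _ _ ha (negPart_nonneg x), ← sub_eq_sub_iff_add_eq_add.1]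
    rw [posPart_sub_negPart, h]
  let F : E →ₗ[ℝ] E :=
    { toFun := fun x => f x⁺ - f x⁻
      map_add' := by
        intro x y
        rw [hsub (x + y) (x⁺ + y⁺) (x⁻ + y⁻) (add_nonneg (posPart_nonneg x) (posPart_nonneg y))
          (add_nonneg (negPart_nonneg x) (negPart_nonneg y)),
          hadd _ _ (posPart_nonneg x) (posPart_nonneg y),
          hadd _ _ (negPart_nonneg x) (negPart_nonneg y)]
        · abel
        · conv_lhs => rw [← posPart_sub_negPart x, ← posPart_sub_negPart y]
          abel
      map_smul' := by
        intro r x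
        rw [RingHom.id_apply]
        rcases le_total 0 r with hr | hr
        · rw [hsub (r • x) (r • x⁺) (r • x⁻) (smul_nonneg hr (posPart_nonneg x))
            (smul_nonneg hr (negPart_nonneg x)), hsmul' r _ hr (posPart_nonneg x),
            hsmul' r _ hr (negPart_nonneg x), ← smul_sub]
          rw [← smul_sub, posPart_sub_negPart]
        · have hr' : 0 ≤ -r := neg_nonneg.2 hr
          rw [hsub (r • x) ((-r) • x⁻) ((-r) • x⁺) (smul_nonneg hr' (negPart_nonneg x))
            (smul_nonneg hr' (posPart_nonneg x)), hsmul' _ _ hr' (negPart_nonneg x),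
            hsmul' _ _ hr' (posPart_nonneg x), ← smul_sub]
          · rw [neg_smul, ← smul_neg, neg_sub]
          · rw [← smul_sub, neg_smul, ← smul_neg, neg_sub, posPart_sub_negPart] }
  have hF : ∀ x, 0 ≤ x → F x = f x := by
    intro x hx
    have h := hsub x x 0 hx le_rfl (sub_zero x).symm
    rwa [f0, sub_zero] at h
  have hmono : ∀ x y, x ≤ y → F x ≤ F y := by
    intro x y hxy
    have h := hnn _ (sub_nonneg.2 hxy)
    rwa [← hF _ (sub_nonneg.2 hxy), map_sub, sub_nonneg] at h
  refine ⟨⟨F, fun a b => ⟨F a, F b, ?_⟩⟩, hF⟩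
  rintro _ ⟨x, hx, rfl⟩
  exact ⟨hmono _ _ hx.1, hmono _ _ hx.2⟩

/-- A bounded non-empty family of positive orthomorphisms has a pointwise supremum, which is an
orthomorphism. No directedness is needed, as the supremum of two orthomorphisms is pointwise. -/
theorem Orth.exists_isLUB {F : Set (Lob E)} (hF : ∀ T ∈ F, T ∈ Orth E) (hne : F.Nonempty)
    (hF0 : ∀ T ∈ F, 0 ≤ T) {M : Lob E} (hM : ∀ T ∈ F, T ≤ M) :
    ∃ Z ∈ Orth E, ∀ x, 0 ≤ x → IsLUB ((fun T : Lob E => T.1 x) '' F) (Z.1 x) := by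
  set f : E → E := fun x => sSup ((fun T : Lob E => T.1 x) '' F) with hf
  have hlub : ∀ x, 0 ≤ x → IsLUB ((fun T : Lob E => T.1 x) '' F) (f x) := fun x hx =>
    isLUB_csSup (hne.image _) ⟨M.1 x, by rintro _ ⟨T, hT, rfl⟩; exact hM T hT x hx⟩
  have hle : ∀ T ∈ F, ∀ x, 0 ≤ x → T.1 x ≤ f x := fun T hT x hx => (hlub x hx).1 ⟨T, hT, rfl⟩
  have hfle : ∀ x b, 0 ≤ x → (∀ T ∈ F, T.1 x ≤ b) → f x ≤ b := fun x b hx h =>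
    (hlub x hx).2 (by rintro _ ⟨T, hT, rfl⟩; exact h T hT)
  obtain ⟨Z, hZ⟩ := exists_lob_of_additive f
    (by
      intro x y hx hy
      apply le_antisymm
      · refine hfle _ _ (add_nonneg hx hy) fun T hT => ?_
        rw [map_add]
        exact add_le_add (hle T hT x hx) (hle T hT y hy)
      · rw [← le_sub_iff_add_le]
        refine hfle _ _ hx fun S hS => ?_
        rw [le_sub_comm]
        refine hfle _ _ hy fun T hT => ?_
        rw [le_sub_iff_add_le']
        calc S.1 x + T.1 y ≤ (S ⊔ T).1 x + (S ⊔ T).1 y :=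
              add_le_add ((le_sup_left : S ≤ S ⊔ T) x hx) ((le_sup_right : T ≤ S ⊔ T) y hy)
          _ = S.1 (x + y) ⊔ T.1 (x + y) := by
              rw [← map_add, Orth.sup_apply (hF S hS) (hF T hT) (add_nonneg hx hy)]
          _ ≤ f (x + y) :=
              sup_le (hle S hS _ (add_nonneg hx hy)) (hle T hT _ (add_nonneg hx hy)))
    (by
      intro r x hr hx
      refine hfle _ _ (smul_nonneg hr.le hx) fun T hT => ?_
      rw [map_smul]
      exact smul_le_smul_of_nonneg_left (hle T hT x hx) hr.le)
    (by
      intro x hx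
      obtain ⟨T, hT⟩ := hne
      exact (hF0 T hT x hx).trans (hle T hT x hx))
  refine ⟨Z, ?_, fun x hx => hZ x hx ▸ hlub x hx⟩
  intro B hB x hx
  have key : ∀ y ∈ B, 0 ≤ y → Z.1 y ∈ B := by
    intro y hy hy0
    rw [hZ y hy0]
    refine hB.isLUB_mem _ _ ?_ (hlub y hy0)
    rintro _ ⟨T, hT, rfl⟩
    exact hF T hT B hB y hy
  have h1 : x⁺ ∈ B := hB.solid hx (by
    rw [abs_of_nonneg (posPart_nonneg x)]; exact posPart_le_abs' x)
  have h2 : x⁻ ∈ B := hB.solid hx (by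
    rw [abs_of_nonneg (negPart_nonneg x)]; exact negPart_le_abs' x)
  rw [← posPart_sub_negPart x, map_sub]
  exact B.sub_mem (key _ h1 (posPart_nonneg x)) (key _ h2 (negPart_nonneg x))

theorem Lob.isGLB_apply {B : Type*} [Preorder B] [IsDirectedOrder B] [Nonempty B] {y : B → Lob E}
    (hy : Antitone y) (hglb : IsGLB (Set.range y) 0) {x : E} (hx : 0 ≤ x) :
    IsGLB (Set.range fun β => (y β).1 x) 0 := by
  have hy0 : ∀ β, 0 ≤ y β := fun β => hglb.1 ⟨β, rfl⟩
  set f : E → E := fun x => sInf (Set.range fun β => (y β).1 x) with hf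
  have hfglb : ∀ x, 0 ≤ x → IsGLB (Set.range fun β => (y β).1 x) (f x) := fun x hx =>
    isGLB_csInf (Set.range_nonempty _) ⟨0, by rintro _ ⟨β, rfl⟩; exact hy0 β x hx⟩
  have hfle : ∀ β x, 0 ≤ x → f x ≤ (y β).1 x := fun β x hx => (hfglb x hx).1 ⟨β, rfl⟩
  have hlef : ∀ x b, 0 ≤ x → (∀ β, b ≤ (y β).1 x) → b ≤ f x := fun x b hx h =>
    (hfglb x hx).2 (by rintro _ ⟨β, rfl⟩; exact h β)
  obtain ⟨R, hR⟩ := exists_lob_of_additive f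
    (by
      intro x z hx hz
      apply le_antisymm
      · rw [← sub_le_iff_le_add]
        refine hlef _ _ hx fun β => ?_
        rw [sub_le_comm]
        refine hlef _ _ hz fun γ => ?_
        rw [sub_le_iff_le_add']
        obtain ⟨δ, hβδ, hγδ⟩ := exists_ge_ge β γ
        calc f (x + z) ≤ (y δ).1 (x + z) := hfle δ _ (add_nonneg hx hz)
          _ = (y δ).1 x + (y δ).1 z := map_add _ _ _
          _ ≤ _ := add_le_add (hy hβδ x hx) (hy hγδ z hz)
      · refine hlef _ _ (add_nonneg hx hz) fun β => ?_
        rw [map_add]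
        exact add_le_add (hfle β x hx) (hfle β z hz))
    (by
      intro r x hr hx
      rw [← inv_smul_le_iff_of_pos hr]
      refine hlef _ _ hx fun β => ?_
      rw [inv_smul_le_iff_of_pos hr, ← map_smul]
      exact hfle β _ (smul_nonneg hr.le hx))
    (fun x hx => hlef x 0 hx fun β => hy0 β x hx)
  have hR0 : R ≤ 0 := hglb.2 (by
    rintro _ ⟨β, rfl⟩ z hz
    rw [hR z hz]
    exact hfle β z hz)
  have hfx : f x = 0 := le_antisymm (hR x hx ▸ hR0 x hx) (hlef x 0 hx fun β => hy0 β x hx)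
  exact hfx ▸ hfglb x hx

/-! ### Order convergence -/

/-- A dominating net may be indexed over any universe: its range, with the reversed order, serves
as an index set in the universe of the lattice. -/
theorem OrderTendsto.of_antitone {X : Type u} [AddCommGroup X] [Lattice X]
    {A : Type v} [Preorder A] {x : A → X} {l : X} {B : Type*} [Preorder B] [IsDirectedOrder B]
    [Nonempty B] {y : B → X} (hy : Antitone y) (hglb : IsGLB (Set.range y) 0)
    (h : ∀ β : B, ∃ α₀ : A, ∀ α : A, α₀ ≤ α → |l - x α| ≤ y β) : OrderTendsto x l := by
  refine ⟨(Set.range y)ᵒᵈ, inferInstance, ⟨?_⟩, ?_, fun w => (OrderDual.ofDual w).1, ?_, ?_, ?_⟩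
  · rintro ⟨_, β, rfl⟩ ⟨_, γ, rfl⟩
    obtain ⟨δ, hβδ, hγδ⟩ := exists_ge_ge β γ
    exact ⟨⟨_, δ, rfl⟩, hy hβδ, hy hγδ⟩
  · exact ⟨⟨_, Classical.arbitrary B, rfl⟩⟩
  · exact fun _ _ h => h
  · exact (Subtype.range_coe (s := Set.range y)).symm ▸ hglb
  · rintro ⟨_, β, rfl⟩
    exact h β

variable {A : Type v} [Preorder A]

/-- A net that decreases to `0` in `Orth E` does so in `Lob E`, as `Orth E` is an ideal of
`Lob E`. -/
theorem Orth.isGLB_coe {B : Type*} {y : B → Orth E} [Nonempty B]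
    (h : IsGLB (Set.range y) 0) : IsGLB (Set.range fun β => (y β : Lob E)) 0 := by
  have hy0 : ∀ β, (0 : Lob E) ≤ y β := fun β => h.1 ⟨β, rfl⟩
  refine ⟨by rintro _ ⟨β, rfl⟩; exact hy0 β, fun W hW => ?_⟩
  have hle : ∀ β, W ⊔ 0 ≤ y β := fun β => sup_le (hW ⟨β, rfl⟩) (hy0 β)
  have hmem : W ⊔ 0 ∈ Orth E := by
    intro D hD x hx
    obtain ⟨β⟩ := ‹Nonempty B›
    have habs : |(W ⊔ 0).1 x| ≤ |(y β : Lob E).1 x| :=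
      calc |(W ⊔ 0).1 x| ≤ (W ⊔ 0).1 |x| := by
            have h0 : 0 ≤ W ⊔ 0 := le_sup_right
            refine abs_le'.2 ⟨Lob.apply_mono h0 (le_abs_self x), ?_⟩
            rw [← map_neg]
            exact Lob.apply_mono h0 (neg_le_abs x)
        _ ≤ (y β : Lob E).1 |x| := hle β _ (abs_nonneg x)
        _ = _ := Orth.apply_abs_of_nonneg (y β).2 (hy0 β) x
    exact hD.solid ((y β).2 D hD x hx) habs
  have h1 : (⟨W ⊔ 0, hmem⟩ : Orth E) ≤ 0 := h.2 (by rintro _ ⟨β, rfl⟩; exact hle β)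
  exact le_sup_left.trans (show W ⊔ 0 ≤ 0 from h1)

theorem Orth.orderTendsto_coe {T : A → Orth E} (h : OrderTendsto T 0) :
    OrderTendsto (fun α => (T α : Lob E)) 0 := by
  obtain ⟨B, _, _, _, y, hy, hglb, hT⟩ := h
  exact ⟨B, _, ‹_›, ‹_›, fun β => y β, hy, Orth.isGLB_coe hglb, hT⟩

theorem Orth.orderTendsto_apply {T : A → Orth E} (h : OrderTendsto (fun α => (T α : Lob E)) 0)
    (x : E) : OrderTendsto (fun α => (T α : Lob E).1 x) 0 := by
  obtain ⟨B, _, _, _, y, hy, hglb, hT⟩ := h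
  refine ⟨B, _, ‹_›, ‹_›, fun β => (y β).1 |x|, fun _ _ h => hy h _ (abs_nonneg x),
    Lob.isGLB_apply hy hglb (abs_nonneg x), fun β => ?_⟩
  obtain ⟨α₀, hα₀⟩ := hT β
  refine ⟨α₀, fun α hα => ?_⟩
  have h1 := hα₀ α hα
  rw [zero_sub, abs_neg] at h1 ⊢
  rw [← Orth.abs_apply_abs (T α).2 x]
  exact h1 _ (abs_nonneg x)

theorem Orth.orderTendsto_of_forall_mem [IsDirectedOrder A] [Nonempty A] {T : A → Orth E}
    {L U : Lob E} (hT : ∀ α, L ≤ T α ∧ (T α : Lob E) ≤ U) {S : Set E}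
    (hS : bandGenerated S = ⊤) (h : ∀ s ∈ S, OrderTendsto (fun α => (T α : Lob E).1 s) 0) :
    OrderTendsto T 0 := by
  have hM : ∀ α, |(T α : Lob E)| ≤ U ⊔ -L := fun α =>
    abs_le'.2 ⟨(hT α).2.trans le_sup_left, (neg_le_neg (hT α).1).trans le_sup_right⟩
  have hsup : ∀ β : A, ∃ Z ∈ Orth E, ∀ x, 0 ≤ x →
      IsLUB ((fun R : Lob E => R.1 x) '' ((fun α => |(T α : Lob E)|) '' Set.Ici β)) (Z.1 x) := by
    intro β
    refine Orth.exists_isLUB ?_ ⟨_, β, Set.self_mem_Ici, rfl⟩ ?_ (M := U ⊔ -L) ?_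
    · rintro _ ⟨α, -, rfl⟩
      exact (|T α| : Orth E).2
    · rintro _ ⟨α, -, rfl⟩
      exact abs_nonneg _
    · rintro _ ⟨α, -, rfl⟩
      exact hM α
  choose Z hZ hlub using hsup
  have hle : ∀ β α, β ≤ α → |(T α : Lob E)| ≤ Z β := fun β α hα x hx =>
    (hlub β x hx).1 ⟨_, ⟨α, hα, rfl⟩, rfl⟩
  have hZle : ∀ β x b, 0 ≤ x → (∀ α, β ≤ α → (|(T α : Lob E)|).1 x ≤ b) → (Z β).1 x ≤ b := by
    intro β x b hx hb
    refine (hlub β x hx).2 ?_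
    rintro _ ⟨_, ⟨α, hα, rfl⟩, rfl⟩
    exact hb α hα
  have hZ0 : ∀ β, 0 ≤ Z β := fun β => (abs_nonneg _).trans (hle β β le_rfl)
  refine OrderTendsto.of_antitone (y := fun β => (⟨Z β, hZ β⟩ : Orth E)) ?_ ⟨?_, ?_⟩ ?_
  · exact fun β γ hβγ x hx => hZle γ x _ hx fun α hα => hle β α (hβγ.trans hα) x hx
  · rintro _ ⟨β, rfl⟩
    exact hZ0 β
  · intro W hW
    -- The positive part `R` of a lower bound `W` vanishes on `S`, hence everywhere.
    set R : Orth E := W ⊔ 0 with hRdef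
    have hR0 : (0 : Lob E) ≤ R := show (0 : Orth E) ≤ R from le_sup_right
    have hRle : ∀ β, (R : Lob E) ≤ Z β := fun β =>
      show R ≤ ⟨Z β, hZ β⟩ from sup_le (hW ⟨β, rfl⟩) (hZ0 β)
    have hker : S ⊆ LinearMap.ker (R : Lob E).1 := by
      intro s hs
      obtain ⟨B, _, _, _, y, -, hglb, hy⟩ := h s hs
      have h1 : (R : Lob E).1 |s| ≤ 0 := by
        refine hglb.2 ?_
        rintro _ ⟨γ, rfl⟩
        obtain ⟨α₀, hα₀⟩ := hy γ
        refine (hRle α₀ _ (abs_nonneg s)).trans (hZle _ _ _ (abs_nonneg s) fun α hα => ?_)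
        have h2 := hα₀ α hα
        rwa [zero_sub, abs_neg, ← Orth.abs_apply_abs (T α).2 s] at h2
      rw [Orth.apply_abs_of_nonneg R.2 hR0] at h1
      exact eq_zero_of_abs_nonpos h1
    have htop : LinearMap.ker (R : Lob E).1 = ⊤ :=
      top_le_iff.1 (hS ▸ sInf_le ⟨Orth.isBand_ker R.2 hR0, hker⟩)
    have hRzero : R ≤ 0 := by
      intro x _
      have hx : x ∈ LinearMap.ker (R : Lob E).1 := htop ▸ Submodule.mem_top
      exact (LinearMap.mem_ker.1 hx).le
    exact le_sup_left.trans hRzero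
  · intro β
    refine ⟨β, fun α hα => ?_⟩
    change |0 - (T α : Lob E)| ≤ Z β
    rw [zero_sub, abs_neg]
    exact hle β α hα

end Complete

end VectorLattice

theorem mainTheorem3 {E : Type*} [AddCommGroup E] [ConditionallyCompleteLattice E]
    [IsOrderedAddMonoid E] [Module ℝ E] [IsOrderedModule ℝ E]
    {A : Type*} [Preorder A] [IsDirectedOrder A] [Nonempty A]
    (T : A → VectorLattice.Orth E)
    (hT : ∃ L U : VectorLattice.Lob E, ∀ α : A, L ≤ (T α : VectorLattice.Lob E) ∧
      (T α : VectorLattice.Lob E) ≤ U) :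
    (∀ S : Set E, S.Nonempty → VectorLattice.bandGenerated S = ⊤ →
      List.TFAE [
        VectorLattice.OrderTendsto T 0,
        VectorLattice.OrderTendsto (fun α => (T α : VectorLattice.Lob E)) 0,
        ∀ s ∈ S, VectorLattice.OrderTendsto (fun α => (T α : VectorLattice.Lob E).1 s) 0,
        ∀ x : E, VectorLattice.OrderTendsto (fun α => (T α : VectorLattice.Lob E).1 x) 0]) ∧
    (∀ e : E, VectorLattice.IsWeakOrderUnit e →
      (VectorLattice.OrderTendsto (fun α => (T α : VectorLattice.Lob E)) 0 ↔
        VectorLattice.OrderTendsto (fun α => (T α : VectorLattice.Lob E).1 e) 0)) := by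
  obtain ⟨L, U, hLU⟩ := hT
  have key : ∀ S : Set E, VectorLattice.bandGenerated S = ⊤ →
      (∀ s ∈ S, VectorLattice.OrderTendsto (fun α => (T α : VectorLattice.Lob E).1 s) 0) →
      VectorLattice.OrderTendsto T 0 := fun S hS h =>
    VectorLattice.Orth.orderTendsto_of_forall_mem hLU hS h
  refine ⟨fun S _ hS => ?_, fun e he => ⟨fun h => ?_, fun h => ?_⟩⟩
  · tfae_have 1 → 2 := VectorLattice.Orth.orderTendsto_coe
    tfae_have 2 → 4 := VectorLattice.Orth.orderTendsto_apply
    tfae_have 4 → 3 := fun h s _ => h s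
    tfae_have 3 → 1 := key S hS
    tfae_finish
  · exact VectorLattice.Orth.orderTendsto_apply h e
  · exact VectorLattice.Orth.orderTendsto_coe (key {e} he (by rintro _ rfl; exact h))
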